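/- **Pseudogroup actions.** Let $\mathfrak X$ be a compact metrizable space with a fixed compatible metric $d$. A (finitely generated) pseudogroup action $\Phi$ on $\mathfrak X$ is given by a partition $\mathfrak X=\mathfrak T_1\sqcup\dots\sqcup\mathfrak T_\nu$ into clopen sets, a reflexive symmetric relation of admissibility on $\{1,\dots,\nu\}$, and, for every admissible pair $(i,j)$, a homeomorphism $h_{j,i}\colon \mathfrak D_{i,j}\to\mathfrak D_{j,i}$ from a nonempty clopen set $\mathfrak D_{i,j}\subset\mathfrak T_i$ onto $\mathfrak D_{j,i}\subset\mathfrak T_j$, with $h_{i,j}=h_{j,i}^{-1}$ and $h_{i,i}=\mathrm{id}_{\mathfrak T_i}$. A sequence $\mathcal I=(i_0,\dots,i_\alpha)$ is admissible if its consecutive pairs are admissible and $h_{\mathcal I}=h_{i_\alpha,i_{\alpha-1}}\circ\dots\circ h_{i_1,i_0}$ has nonempty (maximal) domain. Let $\mathcal G^*$ be the set of all restrictions of such maps $h_{\mathcal I}$ to open subsets of their domains; for $U\subset\mathfrak X$ let $\mathcal G^*_U$ be the set of $g\in\mathcal G^*$ whose domain and range lie in $U$. The action is *equicontinuous* if for every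 $\varepsilon>0$ there is $\delta>0$ such that $d(g(w),g(w'))<\varepsilon$ for all $g\in\mathcal G^*$ and all $w,w'$ in the domain of $g$ with $d(w,w')<\delta$. **Stability.** A clopen set $U\subset\mathfrak X$ is *adapted* with group $\mathcal H_U\subset\mathrm{Homeo}(U)$ if $\mathcal G^*_U$ is exactly the set of restrictions of elements of the group $\mathcal H_U$ to open subsets of $U$. For adapted clopen sets $V\subset U$ let $\mathcal H_{U,V}=\{g\in\mathcal H_U : g(V)=V\}$, and let bars denote closures in $\mathrm{Homeo}(U)$ and $\mathrm{Homeo}(V)$ for the topology of uniform convergence. Restriction to $V$ is a homomorphism $\overline\rho_{U,V}\colon\overline{\mathcal H_{U,V}}\to\overline{\mathcal H_V}$. The action is *stable* if every $x\in\mathfrak X$ lies in an adapted clopen set $U$ such that $\ker\overline\rho_{U,V}$ is trivial for every nonempty adapted clopen set $V\subset U$. **LCSQA.** The action is *locally completely strongly quasi-analytic* (LCSQA) if every $x\in\mathfrak X$ has an open neighbourhood $U$ with the following property. Let $O$ be an open set and let $\widehat g\colon O\to\mathfrak X$ be a continuous map in the closure, for the compact-open topology, of the set of elements of $\mathcal G^*_U$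 with domain $O$. If $\widehat g$ is the identity on some nonempty open subset of $O\cap U$, then $\widehat g$ is the identity on $O$. **Matchbox manifolds.** A foliated chart of dimension $n$ of a space $\mathfrak M$ is a homeomorphism $\varphi$ from an open subset of $\mathfrak M$ onto $(-2,2)^n\times\mathfrak T$, with $\mathfrak T$ a nonempty clopen subset of a given space $\mathfrak X$; its open set is $U_\varphi=\varphi^{-1}((-1,1)^n\times\mathfrak T)$, its projection $\pi\colon U_\varphi\to\mathfrak T$ is the second coordinate of $\varphi$, and its plaques are the fibres of $\pi$. A matchbox manifold of dimension $n$ is a compact connected metrizable space in which, for some compact metrizable $\mathfrak X$, every point $x$ lies in the domain of a foliated chart with $\mathfrak T$ totally disconnected and $\varphi(x)\in\{0\}\times\mathfrak T$. A *regular foliated covering* of $\mathfrak M$ with transversal $\mathfrak X$ (a compact, totally disconnected metrizable space) is a finite family of foliated charts whose open sets $U_1,\dots,U_\nu$ cover $\mathfrak M$ and whose transverse models $\mathfrak T_1,\dots,\mathfrak T_\nu$ partition $\mathfrak X$, such that every plaque of $U_i$ meets at most one plaque of $U_j$, and the sets $\mathfrak D_{i,j}=\pi_i(U_i\cap U_j)$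 are clopen. Its *holonomy pseudogroup* is the pseudogroup action on $\mathfrak X$ in which $(i,j)$ is admissible when $U_i\cap U_j\neq\emptyset$ and $h_{j,i}\colon\mathfrak D_{i,j}\to\mathfrak D_{j,i}$ is given by $h_{j,i}(\pi_i(x))=\pi_j(x)$ for $x\in U_i\cap U_j$. **Theorem.** 1. An equicontinuous pseudogroup action on a Cantor space (a nonempty, compact, totally disconnected, metrizable space without isolated points) is stable if and only if it is LCSQA. 2. Let $\mathfrak M$ be a matchbox manifold with a regular foliated covering whose holonomy pseudogroup is equicontinuous. Then the holonomy pseudogroup is stable if and only if it is LCSQA. -/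

import Mathlib

open Set Topology TopologicalSpace

universe u v

/-! ## Families of local homeomorphisms -/

/-- The restriction of a family `G` of local homeomorphisms of `X` to a subset `W`: the members of
`G` whose domain and range both lie in `W`. -/
def restrictFamily {X : Type u} [TopologicalSpace X] (G : Set (OpenPartialHomeomorph X X))
    (W : Set X) : Set (OpenPartialHomeomorph X X) :=
  {g | g ∈ G ∧ g.source ⊆ W ∧ g.target ⊆ W}

/-- The members with domain `O` of the closure of a family `G` of local homeomorphisms of `X`, in
the compact-open topology: the continuous maps `O → X` that are limits, in the compact-open topology
of `C(O, X)`, of members of `G` with domain `O`. -/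
def closureOn {X : Type u} [TopologicalSpace X] (G : Set (OpenPartialHomeomorph X X))
    (O : Set X) : Set C(O, X) :=
  closure {f : C(O, X) | ∃ g ∈ G, g.source = O ∧ ∀ y : O, f y = g y}

/-- Local complete strong quasi-analyticity of a family of local homeomorphisms: each point has an
open neighbourhood `U` such that every map (with open domain `O`) in the compact-open closure of the
restriction of the family to `U` which is the identity on some nonempty open subset `V` of
its domain is the identity on its whole domain. -/
def IsLCSQA {X : Type u} [TopologicalSpace X] (G : Set (OpenPartialHomeomorph X X)) : Prop :=
  ∀ x : X, ∃ U : Set X, IsOpen U ∧ x ∈ U ∧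
    ∀ O : Set X, IsOpen O → ∀ g ∈ closureOn (restrictFamily G U) O,
      (∃ V : Set X, IsOpen V ∧ V.Nonempty ∧ V ⊆ O ∩ U ∧ ∀ y : O, (y : X) ∈ V → g y = y) →
        ∀ y : O, g y = y

/-! ## Finitely generated pseudogroup actions -/

/-- Generating data of a finitely generated pseudogroup action on `X`: a finite partition of `X` into
clopen sets `T i`, a reflexive symmetric relation `Adm` of admissibility on the indices, and for each
admissible pair `(i, j)` a homeomorphism `h j i` from a nonempty clopen subset of `T i` onto a
nonempty clopen subset of `T j`, with `h i j` inverse to `h j i` and `h i i` the identity of `T i`.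
(The values of `h j i` outside its domain, and `h j i` for non-admissible pairs, play no role;
`≈` is equality of local homeomorphisms on their common domain.) -/
structure PseudogroupAction (X : Type u) [TopologicalSpace X] where
  ν : ℕ
  T : Fin ν → Set X
  isClopen_T : ∀ i, IsClopen (T i)
  disjoint_T : ∀ i j, i ≠ j → Disjoint (T i) (T j)
  iUnion_T : ⋃ i, T i = univ
  Adm : Fin ν → Fin ν → Prop
  adm_refl : ∀ i, Adm i i
  adm_symm : ∀ i j, Adm i j → Adm j i
  h : Fin ν → Fin ν → OpenPartialHomeomorph X X
  source_subset : ∀ i j, Adm i j → (h j i).source ⊆ T i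
  isClopen_source : ∀ i j, Adm i j → IsClopen (h j i).source
  source_nonempty : ∀ i j, Adm i j → (h j i).source.Nonempty
  h_symm : ∀ i j, Adm i j → h i j ≈ (h j i).symm
  h_self : ∀ i, h i i ≈ OpenPartialHomeomorph.ofSet (T i) (isClopen_T i).isOpen

namespace PseudogroupAction

section
variable {X : Type u} [TopologicalSpace X] (Φ : PseudogroupAction X)

/-- The holonomy map of a sequence of indices `(i, l₀, l₁, …)`: the composition
`⋯ ∘ h l₁ l₀ ∘ h l₀ i` on its maximal domain. -/
def holo : Fin Φ.ν → List (Fin Φ.ν) → OpenPartialHomeomorph X X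
  | i, [] => Φ.h i i
  | i, j :: l => (Φ.h j i).trans (holo j l)

/-- A sequence of indices is admissible if consecutive pairs are admissible and the composition of
the corresponding generators has nonempty domain. -/
def AdmissibleSeq (i : Fin Φ.ν) (l : List (Fin Φ.ν)) : Prop :=
  List.IsChain Φ.Adm (i :: l) ∧ (Φ.holo i l).source.Nonempty

/-- The pseudo⋆group of the action: the restrictions of the holonomy maps of admissible sequences
to open subsets of their domains. -/
def star : Set (OpenPartialHomeomorph X X) :=
  {g | ∃ i l, Φ.AdmissibleSeq i l ∧ g.source ⊆ (Φ.holo i l).source ∧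
    EqOn g (Φ.holo i l) g.source}

/-- A clopen set `U` is adapted to the action, with group `H` of homeomorphisms of `U`: the restricted
pseudo⋆group on `U` consists exactly of the restrictions of elements of `H` to open subsets of `U`. -/
def IsAdapted (U : Clopens X) (H : Subgroup (U ≃ₜ U)) : Prop :=
  ∀ g : OpenPartialHomeomorph X X, g ∈ restrictFamily Φ.star (U : Set X) ↔
    ∃ hU : g.source ⊆ U, ∃ k ∈ H, ∀ (x : X) (hx : x ∈ g.source), g x = (k ⟨x, hU hx⟩ : U)

end

/-- Equicontinuity of the action. -/
def IsEquicontinuous {X : Type u} [MetricSpace X] (Φ : PseudogroupAction X) : Prop :=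
  ∀ ε > 0, ∃ δ > 0, ∀ g ∈ Φ.star, ∀ w ∈ g.source, ∀ w' ∈ g.source,
    dist w w' < δ → dist (g w) (g w') < ε

end PseudogroupAction

/-! ## Closures of groups of homeomorphisms, and restriction maps -/

/-- The closure of a group of homeomorphisms of a compact metric space, in the group of all
homeomorphisms with the topology of uniform convergence. -/
def uniformClosure {Y : Type u} [MetricSpace Y] [CompactSpace Y] (H : Subgroup (Y ≃ₜ Y)) :
    Subgroup (Y ≃ₜ Y) where
  carrier := {f | ∀ ε > 0, ∃ k ∈ H, ∀ y, dist (f y) (k y) < ε}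
  one_mem' := fun ε hε => ⟨1, H.one_mem, fun y => by simpa using hε⟩
  mul_mem' := by
    intro a b ha hb ε hε
    obtain ⟨δ, hδ, hd⟩ := Metric.uniformContinuous_iff.mp
      (CompactSpace.uniformContinuous_of_continuous a.continuous) (ε / 2) (half_pos hε)
    obtain ⟨k, hk, hka⟩ := ha (ε / 2) (half_pos hε)
    obtain ⟨l, hl, hlb⟩ := hb δ hδ
    refine ⟨k * l, H.mul_mem hk hl, fun y => ?_⟩
    have h1 : dist (a (b y)) (a (l y)) < ε / 2 := hd (hlb y)
    have h2 : dist (a (l y)) (k (l y)) < ε / 2 := hka (l y)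
    calc dist ((a * b) y) ((k * l) y) = dist (a (b y)) (k (l y)) := rfl
      _ ≤ dist (a (b y)) (a (l y)) + dist (a (l y)) (k (l y)) := dist_triangle _ _ _
      _ < ε := by linarith
  inv_mem' := by
    intro a ha ε hε
    obtain ⟨δ, hδ, hd⟩ := Metric.uniformContinuous_iff.mp
      (CompactSpace.uniformContinuous_of_continuous a.symm.continuous) ε hε
    obtain ⟨k, hk, hka⟩ := ha δ hδ
    refine ⟨k⁻¹, H.inv_mem hk, fun y => ?_⟩
    have h1 := hd (hka (k.symm y))
    rw [a.symm_apply_apply, k.apply_symm_apply, dist_comm] at h1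
    exact h1

section
variable {X : Type u} [MetricSpace X] [CompactSpace X]

instance (U : Clopens X) : CompactSpace U :=
  isCompact_iff_compactSpace.mp U.isClopen.1.isCompact

/-- The homeomorphisms `f` of `U` with `f(V) = V`. -/
def stabilizerOf (U V : Clopens X) : Subgroup (U ≃ₜ U) where
  carrier := {f | ∀ y : U, (f y : X) ∈ V ↔ (y : X) ∈ V}
  one_mem' := fun _ => Iff.rfl
  mul_mem' := fun {a b} ha hb y => (ha (b y)).trans (hb y)
  inv_mem' := fun {a} ha y => by
    have h := ha (a.symm y)
    rw [a.apply_symm_apply] at h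
    exact h.symm

/-- For a group `H` of homeomorphisms of `U`, the subgroup of the `f ∈ H` with `f(V) = V`. -/
def stabilizerIn {U : Clopens X} (H : Subgroup (U ≃ₜ U)) (V : Clopens X) : Subgroup (U ≃ₜ U) :=
  H ⊓ stabilizerOf U V

/-- Restriction to `V ⊆ U` of a homeomorphism of `U` preserving `V`. -/
def restrictHomeo {U V : Clopens X} (hVU : V ≤ U) (f : U ≃ₜ U) (hf : f ∈ stabilizerOf U V) :
    V ≃ₜ V where
  toFun y := ⟨f ⟨y, hVU y.2⟩, (hf _).2 y.2⟩
  invFun y := ⟨f.symm ⟨y, hVU y.2⟩, ((stabilizerOf U V).inv_mem hf _).2 y.2⟩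
  left_inv y := by simp
  right_inv y := by simp
  continuous_toFun := by fun_prop
  continuous_invFun := by fun_prop

/-- Uniform limits of homeomorphisms preserving the clopen set `V` preserve `V`. -/
theorem uniformClosure_stabilizerIn_le {U : Clopens X} (H : Subgroup (U ≃ₜ U)) (V : Clopens X) :
    uniformClosure (stabilizerIn H V) ≤ stabilizerOf U V := by
  have key : ∀ f ∈ uniformClosure (stabilizerIn H V), ∀ y : U, (y : X) ∈ V → (f y : X) ∈ V := by
    intro f hf y hy
    have hc : (f y : X) ∈ closure (V : Set X) := by
      rw [Metric.mem_closure_iff]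
      intro ε hε
      obtain ⟨k, hk, hd⟩ := hf ε hε
      exact ⟨(k y : U), (hk.2 y).2 hy, hd y⟩
    rwa [V.isClopen.1.closure_eq] at hc
  intro f hf y
  refine ⟨fun h => ?_, key f hf y⟩
  have h2 := key f⁻¹ ((uniformClosure (stabilizerIn H V)).inv_mem hf) (f y) h
  have h3 : (f⁻¹ : U ≃ₜ U) (f y) = y := f.symm_apply_apply y
  rwa [h3] at h2

namespace PseudogroupAction

variable {Φ : PseudogroupAction X}

/-- Restriction to `V` maps the stabilizer of `V` in `H_U` to `H_V`. -/
theorem restrictHomeo_mem {U V : Clopens X} {H : Subgroup (U ≃ₜ U)} {K : Subgroup (V ≃ₜ V)}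
    (hU : Φ.IsAdapted U H) (hV : Φ.IsAdapted V K) (hVU : V ≤ U) {f : U ≃ₜ U}
    (hf : f ∈ stabilizerIn H V) : restrictHomeo hVU f hf.2 ∈ K := by
  classical
  let r := restrictHomeo hVU f hf.2
  let g : OpenPartialHomeomorph X X :=
    { toFun := fun x => if hx : x ∈ V then (r ⟨x, hx⟩ : X) else x
      invFun := fun x => if hx : x ∈ V then (r.symm ⟨x, hx⟩ : X) else x
      source := V
      target := V
      map_source' := fun x (hx : x ∈ V) => by simp only [hx, dif_pos]; exact (r ⟨x, hx⟩).2
      map_target' := fun x (hx : x ∈ V) => by simp only [hx, dif_pos]; exact (r.symm ⟨x, hx⟩).2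
      left_inv' := fun x (hx : x ∈ V) => by simp [hx]
      right_inv' := fun x (hx : x ∈ V) => by simp [hx]
      open_source := V.isClopen.2
      open_target := V.isClopen.2
      continuousOn_toFun := by
        rw [continuousOn_iff_continuous_domRestrict]
        have : (V : Set X).domRestrict (fun x => if hx : x ∈ V then (r ⟨x, hx⟩ : X) else x)
            = fun y => ((r y : V) : X) := by
          funext y
          have hy : (y : X) ∈ V := y.2
          simp [Set.domRestrict, hy]
        rw [this]
        exact continuous_subtype_val.comp r.continuous
      continuousOn_invFun := by
        rw [continuousOn_iff_continuous_domRestrict]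
        have : (V : Set X).domRestrict (fun x => if hx : x ∈ V then (r.symm ⟨x, hx⟩ : X) else x)
            = fun y => ((r.symm y : V) : X) := by
          funext y
          have hy : (y : X) ∈ V := y.2
          simp [Set.domRestrict, hy]
        rw [this]
        exact continuous_subtype_val.comp r.symm.continuous }
  have hgx : ∀ (x : X) (hx : x ∈ V), g x = (r ⟨x, hx⟩ : X) := fun x hx => by
    change (if hx : x ∈ V then (r ⟨x, hx⟩ : X) else x) = _
    simp [hx]
  have hgU : g ∈ restrictFamily Φ.star (U : Set X) :=
    (hU g).2 ⟨hVU, f, hf.1, fun x hx => hgx x hx⟩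
  have hgV : g ∈ restrictFamily Φ.star (V : Set X) := ⟨hgU.1, subset_rfl, subset_rfl⟩
  obtain ⟨_, k, hk, hkg⟩ := (hV g).1 hgV
  have : r = k := by
    ext y
    rw [← hgx y y.2]
    exact hkg y y.2
  change r ∈ K
  rw [this]
  exact hk

/-- Restriction to `V` maps the closure of the stabilizer of `V` in `H_U` to the closure of `H_V`. -/
theorem restrictHomeo_mem_closure {U V : Clopens X} {H : Subgroup (U ≃ₜ U)}
    {K : Subgroup (V ≃ₜ V)} (hU : Φ.IsAdapted U H) (hV : Φ.IsAdapted V K) (hVU : V ≤ U)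
    {f : U ≃ₜ U} (hf : f ∈ uniformClosure (stabilizerIn H V)) :
    restrictHomeo hVU f (uniformClosure_stabilizerIn_le H V hf) ∈ uniformClosure K := by
  intro ε hε
  obtain ⟨k, hk, hd⟩ := hf ε hε
  exact ⟨restrictHomeo hVU k hk.2, restrictHomeo_mem hU hV hVU hk, fun y => hd ⟨y, hVU y.2⟩⟩

/-- The restriction homomorphism on closures, from the closure of the group of the elements of `H_U`
preserving `V` to the closure of `H_V`. -/
def restrictionHom {U V : Clopens X} {H : Subgroup (U ≃ₜ U)} {K : Subgroup (V ≃ₜ V)}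
    (hU : Φ.IsAdapted U H) (hV : Φ.IsAdapted V K) (hVU : V ≤ U) :
    uniformClosure (stabilizerIn H V) →* uniformClosure K where
  toFun f := ⟨restrictHomeo hVU f.1 (uniformClosure_stabilizerIn_le H V f.2),
    restrictHomeo_mem_closure hU hV hVU f.2⟩
  map_one' := rfl
  map_mul' _ _ := rfl

/-- The action is stable: each point lies in an adapted clopen set `U` such that for every nonempty
adapted clopen set `V ⊆ U` the restriction homomorphism on closures has trivial kernel. -/
def IsStable (Φ : PseudogroupAction X) : Prop :=
  ∀ x : X, ∃ (U : Clopens X) (H : Subgroup (U ≃ₜ U)) (hU : Φ.IsAdapted U H), x ∈ U ∧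
    ∀ (V : Clopens X) (K : Subgroup (V ≃ₜ V)) (hV : Φ.IsAdapted V K) (hVU : V ≤ U),
      (V : Set X).Nonempty → (restrictionHom hU hV hVU).ker = ⊥

end PseudogroupAction

end

/-! ## Matchbox manifolds and their holonomy pseudogroups -/

/-- A foliated chart of leaf dimension `n` with transverse model a nonempty clopen set `T ⊆ 𝔛`: a
homeomorphism from an open subset of `M` onto `(-2,2)ⁿ × T`. It is thought of as the extension of the
chart proper, whose image is `[-1,1]ⁿ × T`. -/
structure FoliatedChart (n : ℕ) (M : Type v) [TopologicalSpace M] (𝔛 : Type u)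
    [TopologicalSpace 𝔛] where
  T : Set 𝔛
  isClopen_T : IsClopen T
  nonempty_T : T.Nonempty
  φ : OpenPartialHomeomorph M ((Fin n → ℝ) × 𝔛)
  target_eq : φ.target = {p | (∀ k, p.1 k ∈ Ioo (-2 : ℝ) 2) ∧ p.2 ∈ T}

/-- The open set of the chart, the preimage of `(-1,1)ⁿ × T`. -/
def FoliatedChart.dom {n : ℕ} {M : Type v} [TopologicalSpace M] {𝔛 : Type u}
    [TopologicalSpace 𝔛] (c : FoliatedChart n M 𝔛) : Set M :=
  {x | x ∈ c.φ.source ∧ ∀ k, (c.φ x).1 k ∈ Ioo (-1 : ℝ) 1}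

/-- The projection of a chart onto its transverse model. -/
def FoliatedChart.π {n : ℕ} {M : Type v} [TopologicalSpace M] {𝔛 : Type u}
    [TopologicalSpace 𝔛] (c : FoliatedChart n M 𝔛) (x : M) : 𝔛 := (c.φ x).2

/-- A (topological) matchbox manifold of leaf dimension `n`: a continuum (compact connected
metrizable space) in which every point is the centre of a foliated chart with totally disconnected
transverse model in a fixed compact metrizable space `𝔛`. -/
structure IsMatchboxManifold (n : ℕ) (M : Type v) [TopologicalSpace M] : Prop where
  compact : CompactSpace M
  connected : ConnectedSpace M
  metrizable : MetrizableSpace M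
  exists_charts : ∃ (𝔛 : Type v) (_ : TopologicalSpace 𝔛), CompactSpace 𝔛 ∧ MetrizableSpace 𝔛 ∧
    ∀ x : M, ∃ c : FoliatedChart n M 𝔛, IsTotallyDisconnected c.T ∧ x ∈ c.φ.source ∧
      (c.φ x).1 = 0

/-- A regular foliated covering of `M` with transversal `𝔛`: finitely many foliated charts whose open
sets `U i` cover `M` and whose transverse models form a partition of `𝔛` into clopen sets, such
that each plaque of `U i` meets at most one plaque of `U j`, and the
projections `π i (U i ∩ U j)`, which are always open, are clopen. -/
structure RegularFoliatedCovering (n : ℕ) (M : Type v) [TopologicalSpace M] (𝔛 : Type u)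
    [TopologicalSpace 𝔛] where
  ν : ℕ
  chart : Fin ν → FoliatedChart n M 𝔛
  disjoint_T : ∀ i j, i ≠ j → Disjoint (chart i).T (chart j).T
  iUnion_T : ⋃ i, (chart i).T = univ
  iUnion_dom : ⋃ i, (chart i).dom = univ
  plaque_unique : ∀ i j, ∀ x ∈ (chart i).dom ∩ (chart j).dom,
    ∀ y ∈ (chart i).dom ∩ (chart j).dom,
      (chart i).π x = (chart i).π y → (chart j).π x = (chart j).π y
  isClosed_proj : ∀ i j, IsClosed ((chart i).π '' ((chart i).dom ∩ (chart j).dom))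

namespace FoliatedChart

variable {n : ℕ} {M : Type v} [TopologicalSpace M] {𝔛 : Type u} [TopologicalSpace 𝔛]
  (c : FoliatedChart n M 𝔛)

theorem isOpen_dom : IsOpen c.dom := by
  have h : IsOpen {p : (Fin n → ℝ) × 𝔛 | ∀ k, p.1 k ∈ Ioo (-1 : ℝ) 1} := by
    simp only [ofPred_forall]
    exact isOpen_iInter_of_finite fun k =>
      isOpen_Ioo.preimage ((continuous_apply k).comp continuous_fst)
  exact c.φ.isOpen_inter_preimage h

theorem isOpen_π_image {s : Set M} (hs : IsOpen s) (hsd : s ⊆ c.dom) : IsOpen (c.π '' s) := by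
  have h := c.φ.isOpen_image_of_subset_source hs (fun x hx => (hsd hx).1)
  have h2 := isOpenMap_snd _ h
  rwa [image_image] at h2

theorem π_mem {x : M} (hx : x ∈ c.dom) : c.π x ∈ c.T := by
  have h := c.φ.map_source hx.1
  rw [c.target_eq] at h
  exact h.2

theorem exists_π_eq {w : 𝔛} (hw : w ∈ c.T) : ∃ x ∈ c.dom, c.π x = w := by
  have ht : ((0 : Fin n → ℝ), w) ∈ c.φ.target := by
    rw [c.target_eq]
    exact ⟨fun k => by simp, hw⟩
  refine ⟨c.φ.symm (0, w), ⟨c.φ.map_target ht, fun k => ?_⟩, ?_⟩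
  · rw [c.φ.right_inv ht]; simp
  · rw [π, c.φ.right_inv ht]

end FoliatedChart

namespace RegularFoliatedCovering

variable {n : ℕ} {M : Type v} [TopologicalSpace M] {𝔛 : Type u} [TopologicalSpace 𝔛]
  (𝒰 : RegularFoliatedCovering n M 𝔛)

/-- The intersection of the open sets of two charts. -/
def inter (i j : Fin 𝒰.ν) : Set M := (𝒰.chart i).dom ∩ (𝒰.chart j).dom

/-- The set of points of the `i`-th transverse model whose plaque meets the `j`-th chart. -/
def D (i j : Fin 𝒰.ν) : Set 𝔛 := (𝒰.chart i).π '' 𝒰.inter i j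

open Classical in
/-- The transverse change of coordinates from chart `i` to chart `j`: it maps `w` to the parameter of
the plaque of `U j` that meets the plaque of `w` in `U i`. -/
noncomputable def change (j i : Fin 𝒰.ν) (w : 𝔛) : 𝔛 :=
  if hw : ∃ x, x ∈ 𝒰.inter i j ∧ (𝒰.chart i).π x = w then (𝒰.chart j).π hw.choose else w

theorem change_π {i j : Fin 𝒰.ν} {x : M} (hx : x ∈ 𝒰.inter i j) :
    𝒰.change j i ((𝒰.chart i).π x) = (𝒰.chart j).π x := by
  have hw : ∃ y, y ∈ 𝒰.inter i j ∧ (𝒰.chart i).π y = (𝒰.chart i).π x := ⟨x, hx, rfl⟩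
  rw [change, dif_pos hw]
  exact 𝒰.plaque_unique i j _ hw.choose_spec.1 _ hx hw.choose_spec.2

theorem inter_comm {i j : Fin 𝒰.ν} {x : M} (hx : x ∈ 𝒰.inter i j) : x ∈ 𝒰.inter j i :=
  ⟨hx.2, hx.1⟩

theorem isOpen_inter (i j : Fin 𝒰.ν) : IsOpen (𝒰.inter i j) :=
  (𝒰.chart i).isOpen_dom.inter (𝒰.chart j).isOpen_dom

theorem isOpen_D (i j : Fin 𝒰.ν) : IsOpen (𝒰.D i j) :=
  (𝒰.chart i).isOpen_π_image (𝒰.isOpen_inter i j) inter_subset_left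

theorem change_mem {i j : Fin 𝒰.ν} {w : 𝔛} (hw : w ∈ 𝒰.D i j) : 𝒰.change j i w ∈ 𝒰.D j i := by
  obtain ⟨x, hx, rfl⟩ := hw
  rw [𝒰.change_π hx]
  exact ⟨x, 𝒰.inter_comm hx, rfl⟩

theorem change_change {i j : Fin 𝒰.ν} {w : 𝔛} (hw : w ∈ 𝒰.D i j) :
    𝒰.change i j (𝒰.change j i w) = w := by
  obtain ⟨x, hx, rfl⟩ := hw
  rw [𝒰.change_π hx, 𝒰.change_π (𝒰.inter_comm hx)]

theorem continuousOn_change (i j : Fin 𝒰.ν) : ContinuousOn (𝒰.change j i) (𝒰.D i j) := by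
  rw [continuousOn_open_iff (𝒰.isOpen_D i j)]
  intro t ht
  have hπ : ContinuousOn (𝒰.chart j).π (𝒰.inter i j) :=
    continuous_snd.comp_continuousOn
      ((𝒰.chart j).φ.continuousOn.mono fun x hx => hx.2.1)
  have ho := hπ.isOpen_inter_preimage (𝒰.isOpen_inter i j) ht
  have he : 𝒰.D i j ∩ 𝒰.change j i ⁻¹' t
      = (𝒰.chart i).π '' (𝒰.inter i j ∩ (𝒰.chart j).π ⁻¹' t) := by
    ext w
    constructor
    · rintro ⟨⟨x, hx, rfl⟩, hw⟩
      refine ⟨x, ⟨hx, ?_⟩, rfl⟩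
      rwa [mem_preimage, 𝒰.change_π hx] at hw
    · rintro ⟨x, ⟨hx, hxt⟩, rfl⟩
      refine ⟨⟨x, hx, rfl⟩, ?_⟩
      rwa [mem_preimage, 𝒰.change_π hx]
  rw [he]
  exact (𝒰.chart i).isOpen_π_image ho (inter_subset_left.trans inter_subset_left)

/-- The transverse change of coordinates as a homeomorphism from `D i j` onto `D j i`. -/
noncomputable def changeHomeo (j i : Fin 𝒰.ν) : OpenPartialHomeomorph 𝔛 𝔛 where
  toFun := 𝒰.change j i
  invFun := 𝒰.change i j
  source := 𝒰.D i j
  target := 𝒰.D j i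
  map_source' _ hw := 𝒰.change_mem hw
  map_target' _ hw := 𝒰.change_mem hw
  left_inv' _ hw := 𝒰.change_change hw
  right_inv' _ hw := 𝒰.change_change hw
  open_source := 𝒰.isOpen_D i j
  open_target := 𝒰.isOpen_D j i
  continuousOn_toFun := 𝒰.continuousOn_change i j
  continuousOn_invFun := 𝒰.continuousOn_change j i

/-- The holonomy pseudogroup of a regular foliated covering, generated by the transverse changes of
coordinates; a pair of indices is admissible if the open sets of the charts intersect. -/
noncomputable def holonomy : PseudogroupAction 𝔛 where
  ν := 𝒰.ν
  T i := (𝒰.chart i).T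
  isClopen_T i := (𝒰.chart i).isClopen_T
  disjoint_T := 𝒰.disjoint_T
  iUnion_T := 𝒰.iUnion_T
  Adm i j := (𝒰.inter i j).Nonempty
  adm_refl i := by
    obtain ⟨w, hw⟩ := (𝒰.chart i).nonempty_T
    obtain ⟨x, hx, _⟩ := (𝒰.chart i).exists_π_eq hw
    exact ⟨x, hx, hx⟩
  adm_symm _ _ h := h.imp fun _ hx => 𝒰.inter_comm hx
  h j i := 𝒰.changeHomeo j i
  source_subset i j _ := by
    rintro _ ⟨x, hx, rfl⟩
    exact (𝒰.chart i).π_mem hx.1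
  isClopen_source i j _ := ⟨𝒰.isClosed_proj i j, 𝒰.isOpen_D i j⟩
  source_nonempty _ _ h := h.image _
  h_symm _ _ _ := ⟨rfl, fun _ _ => rfl⟩
  h_self i := by
    refine ⟨?_, ?_⟩
    · ext w
      constructor
      · rintro ⟨x, hx, rfl⟩
        exact (𝒰.chart i).π_mem hx.1
      · intro hw
        obtain ⟨x, hx, rfl⟩ := (𝒰.chart i).exists_π_eq hw
        exact ⟨x, ⟨hx, hx⟩, rfl⟩
    · rintro _ ⟨x, hx, rfl⟩
      exact 𝒰.change_π hx

end RegularFoliatedCovering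

/-! Fix a clopen set C and call two points equivalent when the same words in the generators are
defined at both and each such word sends both into C or both outside C. Words carry classes onto
classes. Equicontinuity, together with the finite number of generators and their clopen domains,
makes all points at distance less than some uniform δ equivalent
(`IsEquicontinuous.exists_sameItinerary`), so the classes are clopen. Hence every point has
arbitrarily small adapted clopen neighbourhoods V such that a word taking one point of V into V maps
V onto itself (`IsEquicontinuous.exists_adapted`).

LCSQA gives stability: choose an adapted U inside an LCSQA neighbourhood. A kernel element is a
uniform limit on U of pseudo⋆group elements and fixes V pointwise, so it is the identity on U.

Stability gives LCSQA: a limit map on O is a limit of restrictions of elements of H_U. These are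
equicontinuous, so by an Arzelà–Ascoli argument (`exists_homeomorph_limit`) the limit extends to a
homeomorphism F of U in the closure of H_U. If F fixes an open set pointwise, take a small V inside
it as above. Approximants close to F send a point of V into V, hence preserve V. So F lies in the
closure of H_{U,V} and in the kernel of restriction, and is trivial.

Both parts of the theorem are instances of this equivalence on a compact totally disconnected metric
space. -/

namespace PseudogroupAction

/-! ### Words in the generators, and adapted sets -/

section Words

variable {X : Type u} [TopologicalSpace X] (Φ : PseudogroupAction X)

/-- Composites of generators along chains of admissible pairs from index `i` to index `j`, up to
equality on the domain. The domain may be empty. -/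
inductive IsWord : Fin Φ.ν → Fin Φ.ν → OpenPartialHomeomorph X X → Prop
  | gen {i j : Fin Φ.ν} (h : Φ.Adm i j) : IsWord i j (Φ.h j i)
  | comp {i j k : Fin Φ.ν} {e f : OpenPartialHomeomorph X X} (he : IsWord i j e)
      (hf : IsWord j k f) : IsWord i k (e.trans f)
  | congr {i j : Fin Φ.ν} {e f : OpenPartialHomeomorph X X} (he : IsWord i j e) (hef : e ≈ f) :
      IsWord i j f

variable {Φ}

theorem IsWord.symm {i j : Fin Φ.ν} {e : OpenPartialHomeomorph X X} (he : Φ.IsWord i j e) :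
    Φ.IsWord j i e.symm := by
  induction he with
  | gen h => exact .congr (.gen (Φ.adm_symm _ _ h)) (Φ.h_symm _ _ h)
  | comp _ _ h1 h2 =>
    rw [OpenPartialHomeomorph.trans_symm_eq_symm_trans_symm]
    exact h2.comp h1
  | congr _ hef h => exact h.congr hef.symm'

theorem IsWord.source_subset {i j : Fin Φ.ν} {e : OpenPartialHomeomorph X X}
    (he : Φ.IsWord i j e) : e.source ⊆ Φ.T i := by
  induction he with
  | gen h => exact Φ.source_subset _ _ h
  | comp _ _ h1 _ => exact fun x hx => h1 hx.1
  | congr _ hef h => exact hef.source_eq ▸ h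

theorem IsWord.target_subset {i j : Fin Φ.ν} {e : OpenPartialHomeomorph X X}
    (he : Φ.IsWord i j e) : e.target ⊆ Φ.T j :=
  he.symm.source_subset

theorem eq_of_mem_T {i j : Fin Φ.ν} {x : X} (hi : x ∈ Φ.T i) (hj : x ∈ Φ.T j) : i = j := by
  by_contra h
  exact (Φ.disjoint_T i j h).ne_of_mem hi hj rfl

theorem exists_mem_T (x : X) : ∃ i, x ∈ Φ.T i := by
  have h : x ∈ ⋃ i, Φ.T i := Φ.iUnion_T ▸ mem_univ x
  exact mem_iUnion.1 h

theorem mem_h_self_source {i : Fin Φ.ν} {x : X} : x ∈ (Φ.h i i).source ↔ x ∈ Φ.T i := by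
  rw [(Φ.h_self i).source_eq]; rfl

theorem h_self_apply {i : Fin Φ.ν} {x : X} (hx : x ∈ Φ.T i) : Φ.h i i x = x :=
  (Φ.h_self i).eqOn (mem_h_self_source.2 hx)

theorem h_self_trans {i : Fin Φ.ν} {f : OpenPartialHomeomorph X X} (hf : f.source ⊆ Φ.T i) :
    (Φ.h i i).trans f ≈ f := by
  refine ⟨?_, ?_⟩
  · ext x
    simp only [OpenPartialHomeomorph.trans_source, mem_inter_iff, mem_h_self_source, mem_preimage]
    constructor
    · rintro ⟨h1, h2⟩
      rwa [h_self_apply h1] at h2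
    · exact fun h => ⟨hf h, by rwa [h_self_apply (hf h)]⟩
  · rintro x ⟨hx, _⟩
    exact congrArg f (h_self_apply (mem_h_self_source.1 hx))

theorem isWord_holo (i : Fin Φ.ν) (l : List (Fin Φ.ν)) (hl : List.IsChain Φ.Adm (i :: l)) :
    ∃ j, Φ.IsWord i j (Φ.holo i l) := by
  induction l generalizing i with
  | nil => exact ⟨i, .gen (Φ.adm_refl i)⟩
  | cons j l ih =>
    rw [List.isChain_cons_cons] at hl
    obtain ⟨k, hk⟩ := ih j hl.2
    exact ⟨k, .comp (.gen hl.1) hk⟩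

/-- Every holonomy map ends with the identity of its last clopen piece, which the next map absorbs
on its left. -/
theorem holo_append (i : Fin Φ.ν) (l l' : List (Fin Φ.ν)) (hl : List.IsChain Φ.Adm (i :: l))
    (hl' : List.IsChain Φ.Adm ((i :: l).getLast (List.cons_ne_nil _ _) :: l')) :
    List.IsChain Φ.Adm (i :: (l ++ l')) ∧
      (i :: (l ++ l')).getLast (List.cons_ne_nil _ _)
        = (((i :: l).getLast (List.cons_ne_nil _ _)) :: l').getLast (List.cons_ne_nil _ _) ∧
      (Φ.holo i l).trans (Φ.holo ((i :: l).getLast (List.cons_ne_nil _ _)) l')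
        ≈ Φ.holo i (l ++ l') := by
  induction l generalizing i with
  | nil =>
    obtain ⟨k, hk⟩ := isWord_holo i l' hl'
    exact ⟨hl', rfl, h_self_trans hk.source_subset⟩
  | cons j l ih =>
    rw [List.isChain_cons_cons] at hl
    obtain ⟨h1, h2, h3⟩ := ih j hl.2 hl'
    refine ⟨List.isChain_cons_cons.2 ⟨hl.1, h1⟩, h2, ?_⟩
    change ((Φ.h j i).trans (Φ.holo j l)).trans _ ≈ (Φ.h j i).trans (Φ.holo j (l ++ l'))
    rw [OpenPartialHomeomorph.trans_assoc]
    exact OpenPartialHomeomorph.EqOnSource.trans' (Setoid.refl _) h3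

theorem IsWord.exists_holo {i j : Fin Φ.ν} {e : OpenPartialHomeomorph X X}
    (he : Φ.IsWord i j e) : ∃ l, List.IsChain Φ.Adm (i :: l) ∧
      (i :: l).getLast (List.cons_ne_nil _ _) = j ∧ e ≈ Φ.holo i l := by
  induction he with
  | @gen i j h =>
    -- The holonomy map of `[j]` is the generator followed by the identity `h j j`. Absorption on
    -- the right comes from `h_self_trans` by passing to inverses.
    refine ⟨[j], by simpa using h, rfl, ?_⟩
    have hs := OpenPartialHomeomorph.EqOnSource.symm' (h_self_trans (i := j)
      (f := (Φ.h j i).symm)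
      (IsWord.gen h).target_subset)
    rw [OpenPartialHomeomorph.trans_symm_eq_symm_trans_symm,
      OpenPartialHomeomorph.symm_symm] at hs
    have h2 : (Φ.h j j).symm ≈ Φ.h j j := Setoid.symm (Φ.h_symm j j (Φ.adm_refl j))
    exact Setoid.trans (Setoid.symm hs)
      (OpenPartialHomeomorph.EqOnSource.trans' (Setoid.refl _) h2)
  | comp _ _ h1 h2 =>
    obtain ⟨l, hl, rfl, hle⟩ := h1
    obtain ⟨l', hl', rfl, hle'⟩ := h2
    obtain ⟨a, b, c⟩ := holo_append _ l l' hl hl'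
    exact ⟨_, a, b, Setoid.trans (OpenPartialHomeomorph.EqOnSource.trans' hle hle') c⟩
  | congr _ hef h =>
    obtain ⟨l, hl, hj, hle⟩ := h
    exact ⟨l, hl, hj, Setoid.trans (Setoid.symm hef) hle⟩

/-- Replaces admissible sequences by words, which are visibly closed under inversion and under
composition with matching indices. -/
theorem mem_star_iff {g : OpenPartialHomeomorph X X} :
    g ∈ Φ.star ↔ ∃ i j e, Φ.IsWord i j e ∧ e.source.Nonempty ∧ g.source ⊆ e.source ∧
      EqOn g e g.source := by
  constructor
  · rintro ⟨i, l, ⟨hl, hne⟩, hs, hg⟩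
    obtain ⟨j, hj⟩ := isWord_holo i l hl
    exact ⟨i, j, _, hj, hne, hs, hg⟩
  · rintro ⟨i, j, e, he, hne, hs, hg⟩
    obtain ⟨l, hl, -, hle⟩ := he.exists_holo
    have hse := hle.source_eq
    exact ⟨i, l, ⟨hl, hse ▸ hne⟩, hse ▸ hs, fun x hx => (hg hx).trans (hle.eqOn (hs hx))⟩

/-- Words with composable points compose. -/
theorem IsWord.comp_of_mem {i j i' j' : Fin Φ.ν} {e f : OpenPartialHomeomorph X X}
    (he : Φ.IsWord i j e) (hf : Φ.IsWord i' j' f) {x : X} (hx : x ∈ e.source)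
    (hfx : e x ∈ f.source) : Φ.IsWord i j' (e.trans f) := by
  obtain rfl := eq_of_mem_T (he.target_subset (e.map_source hx)) (hf.source_subset hfx)
  exact he.comp hf

/-- A clopen set mapped onto itself by each word that maps one of its points into it is adapted. -/
theorem exists_isAdapted (U : Clopens X) (hne : (U : Set X).Nonempty)
    (hU : ∀ i j e, Φ.IsWord i j e → ∀ w ∈ U, w ∈ e.source → e w ∈ U →
      (U : Set X) ⊆ e.source ∧ ∀ y ∈ U, e y ∈ U) :
    ∃ H : Subgroup (U ≃ₜ U), Φ.IsAdapted U H := by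
  obtain ⟨w, hw⟩ := hne
  -- The group consists of the homeomorphisms of `U` induced by words defined on all of `U`. The
  -- point `w` forces the indices of two such words to match.
  let H : Subgroup (U ≃ₜ U) :=
    { carrier := {k | ∃ i j e, Φ.IsWord i j e ∧ (U : Set X) ⊆ e.source ∧
        ∀ y : U, (k y : X) = e y}
      one_mem' := by
        obtain ⟨i, hi⟩ := Φ.exists_mem_T w
        have hsub := (hU i i _ (.gen (Φ.adm_refl i)) w hw (mem_h_self_source.2 hi)
          (by rwa [h_self_apply hi])).1
        exact ⟨i, i, _, .gen (Φ.adm_refl i), hsub,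
          fun y => (h_self_apply (mem_h_self_source.1 (hsub y.2))).symm⟩
      mul_mem' := by
        rintro a b ⟨i, j, e, he, hes, hea⟩ ⟨i', j', f, hf, hfs, hfb⟩
        have hfU : ∀ y ∈ U, f y ∈ U := fun y hy => hfb ⟨y, hy⟩ ▸ (b ⟨y, hy⟩).2
        refine ⟨_, _, f.trans e, hf.comp_of_mem he (hfs hw) (hes (hfU w hw)),
          fun y hy => ⟨hfs hy, hes (hfU y hy)⟩, fun y => ?_⟩
        change (a (b y) : X) = e (f y)
        rw [hea, hfb]
      inv_mem' := by
        rintro a ⟨i, j, e, he, hes, hea⟩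
        have ha : ∀ y : U, e (a.symm y) = y := fun y => by rw [← hea, a.apply_symm_apply]
        refine ⟨_, _, e.symm, he.symm, fun y hy => ?_, fun y => ?_⟩
        · rw [← show e (a.symm ⟨y, hy⟩) = y from ha ⟨y, hy⟩]
          exact e.map_source (hes (a.symm ⟨y, hy⟩).2)
        · change (a.symm y : X) = e.symm y
          conv_rhs => rw [← ha y]
          rw [e.left_inv (hes (a.symm y).2)] }
  refine ⟨H, fun g => ⟨?_, ?_⟩⟩
  · rintro ⟨hg, hs, ht⟩
    refine ⟨hs, ?_⟩
    rcases g.source.eq_empty_or_nonempty with h0 | ⟨x, hx⟩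
    · exact ⟨1, H.one_mem, fun x hx => absurd (h0 ▸ hx) (notMem_empty x)⟩
    obtain ⟨i, j, e, he, -, hse, hge⟩ := mem_star_iff.1 hg
    have hex : e x ∈ U := hge hx ▸ ht (g.map_source hx)
    obtain ⟨h1, h2⟩ := hU _ _ e he x (hs hx) (hse hx) hex
    -- The hypothesis on `U` also applies to the inverse word, so `e` maps `U` onto `U`.
    obtain ⟨h3, h4⟩ := hU _ _ e.symm he.symm (e x) hex (e.map_source (hse hx))
      (by rw [e.left_inv (hse hx)]; exact hs hx)
    let k : U ≃ₜ U :=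
      { toFun := fun y => ⟨e y, h2 y y.2⟩
        invFun := fun y => ⟨e.symm y, h4 y y.2⟩
        left_inv := fun y => Subtype.ext (e.left_inv (h1 y.2))
        right_inv := fun y => Subtype.ext (e.right_inv (h3 y.2))
        continuous_toFun := (e.continuousOn.comp_continuous continuous_subtype_val
          fun y => h1 y.2).subtype_mk _
        continuous_invFun := (e.symm.continuousOn.comp_continuous continuous_subtype_val
          fun y => h3 y.2).subtype_mk _ }
    exact ⟨k, ⟨i, j, e, he, h1, fun y => rfl⟩, fun y hy => hge hy⟩
  · rintro ⟨hs, k, ⟨i, j, e, he, hes, hke⟩, hgk⟩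
    refine ⟨mem_star_iff.2 ⟨i, j, e, he, ⟨w, hes hw⟩, hs.trans hes, fun y hy => ?_⟩, hs,
      fun y hy => ?_⟩
    · rw [hgk y hy, hke]
    · rw [← g.right_inv hy, hgk _ (g.map_target hy)]
      exact Subtype.prop _

/-- The local homeomorphism of `X` given by a homeomorphism of a nonempty clopen subset. -/
theorem exists_openPartialHomeomorph (U : Clopens X) (hne : (U : Set X).Nonempty) (k : U ≃ₜ U) :
    ∃ g : OpenPartialHomeomorph X X, g.source = U ∧ g.target = U ∧ ∀ y : U, g y = k y := by
  have : Nonempty U := hne.to_subtype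
  have ho : IsOpenEmbedding ((↑) : U → X) := U.isClopen.2.isOpenEmbedding_subtypeVal
  let s := ho.toOpenPartialHomeomorph
  have hs : ∀ y : U, s.symm y = y := fun y => s.left_inv (mem_univ y)
  refine ⟨(s.symm.trans k.toOpenPartialHomeomorph).trans s, ?_, ?_, fun y => ?_⟩
  · simp [s]
  · simp [s]
  · change s (k (s.symm y)) = k y
    rw [hs]; rfl

/-- The elements of the group of an adapted set are restrictions of words. -/
theorem IsAdapted.exists_word {U : Clopens X} {H : Subgroup (U ≃ₜ U)} (hU : Φ.IsAdapted U H)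
    (hne : (U : Set X).Nonempty) {k : U ≃ₜ U} (hk : k ∈ H) :
    ∃ i j e, Φ.IsWord i j e ∧ (U : Set X) ⊆ e.source ∧ ∀ y : U, (k y : X) = e y := by
  obtain ⟨g, hs, ht, hg⟩ := exists_openPartialHomeomorph U hne k
  have := (hU g).2 ⟨hs.le, k, hk, fun x hx => hg ⟨x, hs.le hx⟩⟩
  obtain ⟨i, j, e, he, -, hse, hge⟩ := mem_star_iff.1 this.1
  rw [hs] at hse hge
  exact ⟨i, j, e, he, hse, fun y => (hg y).symm.trans (hge y.2)⟩

end Words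

/-! ### Itinerary classes -/

section Classes

variable {X : Type u} [TopologicalSpace X] (Φ : PseudogroupAction X)

/-- Two points lie in the domains of the same words, and their images under each of these lie on the
same side of `C`. -/
def SameItinerary (C : Set X) (w w' : X) : Prop :=
  ∀ i j e, Φ.IsWord i j e → (w ∈ e.source ↔ w' ∈ e.source) ∧
    (w ∈ e.source → (e w ∈ C ↔ e w' ∈ C))

variable {Φ}

theorem SameItinerary.refl (C : Set X) (w : X) : Φ.SameItinerary C w w :=
  fun _ _ _ _ => ⟨Iff.rfl, fun _ => Iff.rfl⟩

theorem SameItinerary.symm {C : Set X} {w w' : X} (h : Φ.SameItinerary C w w') :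
    Φ.SameItinerary C w' w :=
  fun i j e he => ⟨(h i j e he).1.symm,
    fun hw => ((h i j e he).2 ((h i j e he).1.2 hw)).symm⟩

theorem SameItinerary.trans {C : Set X} {w w' w'' : X} (h : Φ.SameItinerary C w w')
    (h' : Φ.SameItinerary C w' w'') : Φ.SameItinerary C w w'' :=
  fun i j e he => ⟨(h i j e he).1.trans (h' i j e he).1, fun hw =>
    ((h i j e he).2 hw).trans ((h' i j e he).2 ((h i j e he).1.1 hw))⟩

/-- Testing `f` at `e w` is testing `e.trans f` at `w`. That composite is known to be a word only
once it is defined at one of the two points, so each direction uses its own point. -/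
theorem SameItinerary.map {C : Set X} {w w' : X} (h : Φ.SameItinerary C w w') {i j : Fin Φ.ν}
    {e : OpenPartialHomeomorph X X} (he : Φ.IsWord i j e) (hw : w ∈ e.source) :
    Φ.SameItinerary C (e w) (e w') := by
  have hw' := (h i j e he).1.1 hw
  intro i' j' f hf
  have key : e w ∈ f.source ↔ e w' ∈ f.source := by
    constructor
    · intro hfw
      exact ((h _ _ _ (he.comp_of_mem hf hw hfw)).1.1 ⟨hw, hfw⟩).2
    · intro hfw
      exact ((h _ _ _ (he.comp_of_mem hf hw' hfw)).1.2 ⟨hw', hfw⟩).2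
  exact ⟨key, fun hfw => (h _ _ _ (he.comp_of_mem hf hw hfw)).2 ⟨hw, hfw⟩⟩

theorem SameItinerary.mem {C : Set X} {w w' : X} (h : Φ.SameItinerary C w w') (hw : w ∈ C) :
    w' ∈ C := by
  obtain ⟨i, hi⟩ := Φ.exists_mem_T w
  have h1 := h i i _ (.gen (Φ.adm_refl i))
  have h2 := h1.1.1 (mem_h_self_source.2 hi)
  have h3 := h1.2 (mem_h_self_source.2 hi)
  rw [h_self_apply hi, h_self_apply (mem_h_self_source.1 h2)] at h3
  exact h3.1 hw

end Classes

/-! ### Clopen itinerary classes from equicontinuity -/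

section Metric

variable {X : Type u} [MetricSpace X] [CompactSpace X] {Φ : PseudogroupAction X}

/-- A Lebesgue number of the cover by `C` and its complement. -/
theorem _root_.IsClopen.exists_forall_dist_lt {Y : Type*} [PseudoMetricSpace Y] [CompactSpace Y]
    {C : Set Y} (hC : IsClopen C) :
    ∃ η > 0, ∀ a b : Y, dist a b < η → (a ∈ C → b ∈ C) := by
  obtain ⟨η, hη, h⟩ := lebesgue_number_lemma_of_metric_sUnion (c := {C, Cᶜ}) isCompact_univ
    (by rintro t (rfl | rfl); exacts [hC.2, hC.compl.2]) (by simp)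
  refine ⟨η, hη, fun a b hab ha => ?_⟩
  obtain ⟨t, ht, hs⟩ := h a (mem_univ a)
  rcases ht with rfl | rfl
  · exact hs (by rwa [Metric.mem_ball, dist_comm])
  · exact absurd ha (hs (Metric.mem_ball_self hη))

theorem IsEquicontinuous.of_isWord (hΦ : Φ.IsEquicontinuous) {ε : ℝ} (hε : 0 < ε) :
    ∃ δ > 0, ∀ i j e, Φ.IsWord i j e → ∀ w ∈ e.source, ∀ w' ∈ e.source,
      dist w w' < δ → dist (e w) (e w') < ε := by
  obtain ⟨δ, hδ, h⟩ := hΦ ε hε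
  exact ⟨δ, hδ, fun i j e he w hw => h e
    (mem_star_iff.2 ⟨i, j, e, he, ⟨w, hw⟩, subset_rfl, fun _ _ => rfl⟩) w hw⟩

/-- A word ceases to be defined only at the domain of some generator, and these finitely many clopen
domains have a common Lebesgue number. Equicontinuity keeps the images of two close points below it,
whatever the length of the word. -/
theorem IsEquicontinuous.exists_sameItinerary (hΦ : Φ.IsEquicontinuous) {C : Set X}
    (hC : IsClopen C) :
    ∃ δ > 0, ∀ w w' : X, dist w w' < δ → Φ.SameItinerary C w w' := by
  obtain ⟨η, hη, hη1⟩ := hC.exists_forall_dist_lt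
  have hs : ∀ p : Fin Φ.ν × Fin Φ.ν, ∃ θ > 0, ∀ a b : X, dist a b < θ → Φ.Adm p.1 p.2 →
      a ∈ (Φ.h p.2 p.1).source → b ∈ (Φ.h p.2 p.1).source := by
    intro p
    by_cases hp : Φ.Adm p.1 p.2
    · obtain ⟨θ, hθ, h⟩ := (Φ.isClopen_source _ _ hp).exists_forall_dist_lt
      exact ⟨θ, hθ, fun a b hab _ => h a b hab⟩
    · exact ⟨1, one_pos, fun _ _ _ h => absurd h hp⟩
  choose θ hθ hθ1 using hs
  obtain ⟨ε, hε, hεθ⟩ : ∃ ε > 0, ε ≤ η ∧ ∀ p, ε ≤ θ p := by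
    have h : ∀ᶠ ε in 𝓝[>] (0 : ℝ), ε ≤ η ∧ ∀ p, ε ≤ θ p := by
      refine Filter.Eventually.and ?_ (Filter.eventually_all.2 fun p => ?_)
      · exact nhdsWithin_le_nhds (eventually_le_nhds hη)
      · exact nhdsWithin_le_nhds (eventually_le_nhds (hθ p))
    obtain ⟨ε, h1, h2⟩ := (h.and self_mem_nhdsWithin).exists
    exact ⟨ε, h2, h1⟩
  obtain ⟨δ, hδ, hδ1⟩ := hΦ.of_isWord hε
  -- The prefix `e` already applied is carried through the induction. Equicontinuity is used for the
  -- whole prefix at once, so errors do not accumulate with the length.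
  have step : ∀ i j f, Φ.IsWord i j f → ∀ k e, Φ.IsWord k i e → ∀ w ∈ e.source, ∀ w' ∈ e.source,
      dist w w' < δ → e w ∈ f.source → e w' ∈ f.source := by
    intro i j f hf
    induction hf with
    | @gen i j hij =>
      intro k e he w hw w' hw' hd hf
      exact hθ1 (i, j) _ _ ((hδ1 _ _ e he w hw w' hw' hd).trans_le (hεθ.2 _)) hij hf
    | comp h1 _ ih1 ih2 =>
      intro k e he w hw w' hw' hd hf
      have h3 := ih1 k e he w hw w' hw' hd hf.1
      exact ⟨h3, ih2 k _ (he.comp h1) w ⟨hw, hf.1⟩ w' ⟨hw', h3⟩ hd hf.2⟩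
    | congr _ hef ih =>
      intro k e he w hw w' hw' hd hf
      rw [← hef.source_eq] at hf ⊢
      exact ih k e he w hw w' hw' hd hf
  have dom : ∀ w w', dist w w' < min ε δ → ∀ i j e, Φ.IsWord i j e → w ∈ e.source →
      w' ∈ e.source := by
    intro w w' hd i j e he hw
    have hi := he.source_subset hw
    have h1 : w' ∈ (Φ.h i i).source := hθ1 (i, i) w w'
      ((hd.trans_le (min_le_left _ _)).trans_le (hεθ.2 _)) (Φ.adm_refl i)
      (mem_h_self_source.2 hi)
    have h2 := step i j e he i _ (.gen (Φ.adm_refl i)) w (mem_h_self_source.2 hi) w' h1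
      (hd.trans_le (min_le_right _ _)) (by rwa [h_self_apply hi])
    rwa [h_self_apply (mem_h_self_source.1 h1)] at h2
  refine ⟨min ε δ, lt_min hε hδ, fun w w' hd i j e he => ?_⟩
  have hd' : dist w' w < min ε δ := by rwa [dist_comm]
  refine ⟨⟨dom w w' hd i j e he, dom w' w hd' i j e he⟩, fun hw => ?_⟩
  have h1 := (hδ1 _ _ e he w hw w' (dom w w' hd i j e he hw)
    (hd.trans_le (min_le_right _ _))).trans_le hεθ.1
  exact ⟨hη1 _ _ h1, hη1 _ _ (by rwa [dist_comm])⟩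

/-- For an equicontinuous action, each neighbourhood of `x` contains an adapted clopen set containing
`x`, which each word either maps onto itself or moves off itself. -/
theorem IsEquicontinuous.exists_adapted [TotallyDisconnectedSpace X] (hΦ : Φ.IsEquicontinuous)
    {W : Set X} (hW : IsOpen W) {x : X} (hx : x ∈ W) :
    ∃ (U : Clopens X) (H : Subgroup (U ≃ₜ U)), Φ.IsAdapted U H ∧ x ∈ U ∧ (U : Set X) ⊆ W ∧
      ∀ i j e, Φ.IsWord i j e → ∀ w ∈ U, w ∈ e.source → e w ∈ U →
        (U : Set X) ⊆ e.source ∧ ∀ y ∈ U, e y ∈ U := by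
  obtain ⟨C, hC, hxC, hCW⟩ := compact_exists_isClopen_in_isOpen hW hx
  obtain ⟨δ, hδ, hd⟩ := hΦ.exists_sameItinerary hC
  -- The class of `x`. With any point it contains the δ-ball around it, and so does its complement.
  let S : Set X := {w | Φ.SameItinerary C x w}
  have hS : IsClopen S := by
    constructor
    · rw [← isOpen_compl_iff, Metric.isOpen_iff]
      exact fun w hw => ⟨δ, hδ, fun w' hw' h => hw (h.trans (hd _ _ hw'))⟩
    · rw [Metric.isOpen_iff]
      exact fun w hw => ⟨δ, hδ, fun w' hw' => hw.trans (hd _ _ hw').symm⟩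
  have hU : ∀ i j e, Φ.IsWord i j e → ∀ w ∈ S, w ∈ e.source → e w ∈ S →
      S ⊆ e.source ∧ ∀ y ∈ S, e y ∈ S := by
    intro i j e he w hw hwe hew
    have h : ∀ y ∈ S, Φ.SameItinerary C w y := fun y hy => hw.symm.trans hy
    exact ⟨fun y hy => (h y hy i j e he).1.1 hwe, fun y hy => hew.trans ((h y hy).map he hwe)⟩
  obtain ⟨H, hH⟩ := exists_isAdapted ⟨S, hS⟩ ⟨x, .refl C x⟩ hU
  exact ⟨⟨S, hS⟩, H, hH, .refl C x, fun w hw => hCW (SameItinerary.mem hw hxC), hU⟩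

end Metric

/-! ### Compactness of equicontinuous groups -/

/-- An ultrafilter on an equicontinuous group of homeomorphisms of a compact metric space converges
uniformly to a homeomorphism. -/
theorem _root_.exists_homeomorph_limit {Y : Type*} [MetricSpace Y] [CompactSpace Y]
    {H : Subgroup (Y ≃ₜ Y)}
    (hH : ∀ ε > 0, ∃ δ > 0, ∀ k ∈ H, ∀ y y', dist y y' < δ → dist (k y) (k y') < ε)
    (L : Ultrafilter (Y ≃ₜ Y)) (hL : ∀ᶠ k in (L : Filter (Y ≃ₜ Y)), k ∈ H) :
    ∃ f : Y ≃ₜ Y, ∀ ε > 0, ∀ᶠ k in (L : Filter (Y ≃ₜ Y)), ∀ y, dist (f y) (k y) < ε := by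
  have lim : ∀ c : (Y ≃ₜ Y) → Y, ∃ z, Filter.Tendsto c L (𝓝 z) := fun c => by
    obtain ⟨z, -, hz⟩ := isCompact_univ.ultrafilter_le_nhds (L.map c) (by simp)
    exact ⟨z, hz⟩
  choose F hF using fun y => lim fun k => k y
  choose G hG using fun y => lim fun k => k.symm y
  -- Stated for a general family `c` so as to apply both to the maps `k` and to their inverses:
  -- pointwise limits of equicontinuous maps are continuous, and a finite δ-net makes the
  -- convergence uniform.
  have unif : ∀ (c : (Y ≃ₜ Y) → Y → Y) (A : Y → Y),
      (∀ ε > 0, ∃ δ > 0, ∀ k ∈ H, ∀ y y', dist y y' < δ → dist (c k y) (c k y') < ε) →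
      (∀ y, Filter.Tendsto (fun k => c k y) L (𝓝 (A y))) → Continuous A ∧
      ∀ ε > 0, ∀ᶠ k in (L : Filter (Y ≃ₜ Y)), ∀ y, dist (A y) (c k y) < ε := by
    intro c A hc hA
    have hA2 : ∀ ε > 0, ∃ δ > 0,
        (∀ k ∈ H, ∀ y y', dist y y' < δ → dist (c k y) (c k y') < ε) ∧
        ∀ y y', dist y y' < δ → dist (A y) (A y') ≤ ε := by
      intro ε hε
      obtain ⟨δ, hδ, h⟩ := hc ε hε
      refine ⟨δ, hδ, h, fun y y' hd => ?_⟩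
      exact le_of_tendsto ((hA y).dist (hA y')) (hL.mono fun k hk => (h k hk y y' hd).le)
    refine ⟨Metric.continuous_iff.2 fun b ε hε => ?_, fun ε hε => ?_⟩
    · obtain ⟨δ, hδ, -, h⟩ := hA2 (ε / 2) (by positivity)
      exact ⟨δ, hδ, fun a ha => (h a b ha).trans_lt (by linarith)⟩
    · obtain ⟨δ, hδ, h1, h2⟩ := hA2 (ε / 3) (by positivity)
      obtain ⟨t, -, ht, hcov⟩ := Metric.finite_approx_of_totallyBounded
        (isCompact_univ (X := Y)).totallyBounded δ hδ
      have hev : ∀ᶠ k in (L : Filter (Y ≃ₜ Y)), ∀ z ∈ t, dist (c k z) (A z) < ε / 3 :=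
        (Filter.eventually_all_finite ht).2 fun z _ =>
          Metric.tendsto_nhds.1 (hA z) _ (by positivity)
      filter_upwards [hev, hL] with k hk hkH y
      obtain ⟨z, hz, hyz⟩ := mem_iUnion₂.1 (hcov (mem_univ y))
      have e1 := h2 y z hyz
      have e2 := hk z hz
      have e3 := h1 k hkH y z hyz
      rw [dist_comm] at e2 e3
      have := dist_triangle4 (A y) (A z) (c k z) (c k y)
      linarith
  obtain ⟨hFc, hFu⟩ := unif (fun k y => k y) F hH hF
  obtain ⟨hGc, hGu⟩ := unif (fun k y => k.symm y) G (fun ε hε => by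
    obtain ⟨δ, hδ, h⟩ := hH ε hε
    exact ⟨δ, hδ, fun k hk => h k⁻¹ (H.inv_mem hk)⟩) hG
  have inv : ∀ (c c' : (Y ≃ₜ Y) → Y → Y) (A B : Y → Y), (∀ k y, c k (c' k y) = y) →
      Continuous A → (∀ ε > 0, ∀ᶠ k in (L : Filter (Y ≃ₜ Y)), ∀ y, dist (A y) (c k y) < ε) →
      (∀ y, Filter.Tendsto (fun k => c' k y) L (𝓝 (B y))) → ∀ y, A (B y) = y := by
    intro c c' A B hcc hAc hA hB y
    refine tendsto_nhds_unique ((hAc.tendsto (B y)).comp (hB y)) ?_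
    rw [Metric.tendsto_nhds]
    intro ε hε
    filter_upwards [hA ε hε] with k hk
    simpa [hcc] using hk (c' k y)
  exact ⟨{ toFun := F, invFun := G,
           left_inv := inv _ _ G F (fun k y => k.symm_apply_apply y) hGc hGu hF
           right_inv := inv _ _ F G (fun k y => k.apply_symm_apply y) hFc hFu hG
           continuous_toFun := hFc, continuous_invFun := hGc }, hFu⟩

/-! ### Stability and LCSQA -/

variable {X : Type u} [MetricSpace X] [CompactSpace X] {Φ : PseudogroupAction X}

theorem IsAdapted.equicontinuous {U : Clopens X} {H : Subgroup (U ≃ₜ U)} (hU : Φ.IsAdapted U H)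
    (hΦ : Φ.IsEquicontinuous) :
    ∀ ε > 0, ∃ δ > 0, ∀ k ∈ H, ∀ y y', dist y y' < δ → dist (k y) (k y') < ε := by
  intro ε hε
  obtain ⟨δ, hδ, h⟩ := hΦ.of_isWord hε
  refine ⟨δ, hδ, fun k hk y y' hd => ?_⟩
  obtain ⟨i, j, e, he, hs, hke⟩ := hU.exists_word ⟨y, y.2⟩ hk
  rw [Subtype.dist_eq, hke, hke]
  exact h i j e he y (hs y.2) y' (hs y'.2) hd

theorem isStable_of_isLCSQA [TotallyDisconnectedSpace X] (hΦ : Φ.IsEquicontinuous)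
    (h : IsLCSQA Φ.star) : Φ.IsStable := by
  intro x
  obtain ⟨W, hW, hxW, hq⟩ := h x
  obtain ⟨U, H, hU, hxU, hUW, -⟩ := hΦ.exists_adapted hW hxW
  refine ⟨U, H, hU, hxU, fun V K hV hVU hVne => ?_⟩
  rw [Subgroup.eq_bot_iff_forall]
  intro f hf
  have hfV : ∀ y : X, ∀ hy : y ∈ V, (f.1 ⟨y, hVU hy⟩ : X) = y := fun y hy => by
    have h1 := congrArg (fun r : uniformClosure K => ((r.1 ⟨y, hy⟩ : V) : X))
      (MonoidHom.mem_ker.1 hf)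
    exact h1
  let fc : C((U : Set X), X) := ⟨fun y => (f.1 y : X), continuous_subtype_val.comp f.1.continuous⟩
  have hfc : fc ∈ closureOn (restrictFamily Φ.star W) (U : Set X) := by
    -- On the compact domain `U` the compact-open topology is that of the uniform distance.
    have : CompactSpace (U : Set X) := isCompact_iff_compactSpace.mp U.isClopen.1.isCompact
    rw [closureOn, Metric.mem_closure_iff]
    intro ε hε
    obtain ⟨k, hk, hd⟩ := f.2 ε hε
    obtain ⟨g, hs, ht, hg⟩ := exists_openPartialHomeomorph U ⟨x, hxU⟩ k
    have hgU := (hU g).2 ⟨hs.le, k, hk.1, fun z hz => hg ⟨z, hs.le hz⟩⟩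
    refine ⟨⟨fun y => (k y : X), continuous_subtype_val.comp k.continuous⟩,
      ⟨g, ⟨hgU.1, hgU.2.1.trans hUW, hgU.2.2.trans hUW⟩, hs, fun y => (hg y).symm⟩, ?_⟩
    rw [ContinuousMap.dist_lt_iff hε]
    exact fun y => hd y
  have hid := hq U U.isClopen.2 fc hfc ⟨V, V.isClopen.2, hVne,
    fun y hy => ⟨hVU hy, hUW (hVU hy)⟩, fun y hy => hfV y hy⟩
  exact Subtype.ext (Homeomorph.ext fun y => Subtype.ext (hid y))

theorem IsStable.isLCSQA [TotallyDisconnectedSpace X] (hΦ : Φ.IsEquicontinuous)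
    (h : Φ.IsStable) : IsLCSQA Φ.star := by
  intro x
  obtain ⟨U, H, hU, hxU, hker⟩ := h x
  refine ⟨U, U.isClopen.2, hxU, fun O _ g hg hV => ?_⟩
  obtain ⟨V₀, hV₀, ⟨v, hv⟩, hV₀O, hgV₀⟩ := hV
  obtain ⟨V, K, hVK, hvV, hVV₀, hVw⟩ := hΦ.exists_adapted hV₀ hv
  have hVU : V ≤ U := fun y hy => (hV₀O (hVV₀ hy)).2
  -- The open set `O` need not be compact; only pointwise convergence along `L` is used below.
  obtain ⟨L, hLS, hLg⟩ := mem_closure_iff_ultrafilter.1 hg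
  have hext : ∀ f : C(O, X), ∃ k : U ≃ₜ U,
      (∃ g ∈ restrictFamily Φ.star (U : Set X), g.source = O ∧ ∀ y : O, f y = g y) →
        k ∈ H ∧ ∃ hO : O ⊆ U, ∀ y : O, f y = k ⟨y, hO y.2⟩ := by
    intro f
    by_cases hf : ∃ g ∈ restrictFamily Φ.star (U : Set X), g.source = O ∧ ∀ y : O, f y = g y
    · obtain ⟨a, ha, rfl, hfg⟩ := hf
      obtain ⟨hs, k, hk, hgk⟩ := (hU a).1 ha
      exact ⟨k, fun _ => ⟨hk, hs, fun y => (hfg y).trans (hgk y y.2)⟩⟩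
    · exact ⟨1, fun h => absurd h hf⟩
  choose E hE using hext
  have hev : ∀ᶠ f in (L : Filter C(O, X)),
      E f ∈ H ∧ ∃ hO : O ⊆ U, ∀ y : O, f y = E f ⟨y, hO y.2⟩ :=
    Filter.mem_of_superset hLS fun f hf => hE f hf
  obtain ⟨F, hF⟩ := exists_homeomorph_limit (hU.equicontinuous hΦ) (L.map E)
    (hev.mono fun f hf => hf.1)
  have hOU : O ⊆ U := by
    obtain ⟨f, -, hO, -⟩ := hev.exists
    exact hO
  have hgF : ∀ y : O, g y = F ⟨y, hOU y.2⟩ := by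
    intro y
    have h1 : Filter.Tendsto (fun f : C(O, X) => f y) L (𝓝 (g y)) :=
      ((continuous_eval_const y).tendsto g).mono_left hLg
    refine tendsto_nhds_unique h1 ?_
    rw [Metric.tendsto_nhds]
    intro ε hε
    have h2 : ∀ᶠ f in (L : Filter C(O, X)), ∀ y, dist (F y) (E f y) < ε := hF ε hε
    filter_upwards [h2, hev] with f hf hfE
    obtain ⟨-, hO, hfy⟩ := hfE
    rw [hfy, dist_comm]
    exact hf _
  have hFV : ∀ y (hy : y ∈ V), (F ⟨y, hVU hy⟩ : X) = y := fun y hy =>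
    (hgF ⟨y, (hV₀O (hVV₀ hy)).1⟩).symm.trans (hgV₀ _ (hVV₀ hy))
  have hFmem : F ∈ uniformClosure (stabilizerIn H V) := by
    intro ε hε
    -- As `F` fixes `v`, an approximant within `r` of `F` sends `v` into `V`, and the choice of `V`
    -- then makes it preserve `V`.
    obtain ⟨r, hr, hrV⟩ := Metric.isOpen_iff.1 V.isClopen.2 v hvV
    have h2 : ∀ᶠ f in (L : Filter C(O, X)), ∀ y, dist (F y) (E f y) < min ε r :=
      hF _ (lt_min hε hr)
    obtain ⟨f, hf, hfH, -⟩ := (h2.and hev).exists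
    refine ⟨E f, ⟨hfH, ?_⟩, fun y => (hf y).trans_le (min_le_left _ _)⟩
    obtain ⟨i, j, e, he, hes, hEe⟩ := hU.exists_word ⟨x, hxU⟩ hfH
    have hev' : e v ∈ V := by
      have h3 := (hf ⟨v, hVU hvV⟩).trans_le (min_le_right _ _)
      rw [Subtype.dist_eq, hFV v hvV, hEe, dist_comm] at h3
      exact hrV h3
    have hvs := hes (hVU hvV)
    obtain ⟨-, h4⟩ := hVw i j e he v hvV hvs hev'
    obtain ⟨-, h5⟩ := hVw j i e.symm he.symm (e v) hev' (e.map_source hvs)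
      (by rwa [e.left_inv hvs])
    intro y
    rw [hEe]
    refine ⟨fun hy => ?_, fun hy => h4 y hy⟩
    have h6 := h5 _ hy
    rwa [e.left_inv (hes y.2)] at h6
  have hk := hker V K hVK hVU ⟨v, hvV⟩
  rw [Subgroup.eq_bot_iff_forall] at hk
  have hF1 : F = 1 := congrArg Subtype.val (hk ⟨F, hFmem⟩ (MonoidHom.mem_ker.2
    (Subtype.ext (Homeomorph.ext fun y => Subtype.ext (hFV y y.2)))))
  intro y
  rw [hgF y, hF1]
  rfl

/-- For an equicontinuous action on a compact totally disconnected metric space, stability is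
equivalent to local complete strong quasi-analyticity. -/
theorem isStable_iff_isLCSQA [TotallyDisconnectedSpace X] (hΦ : Φ.IsEquicontinuous) :
    Φ.IsStable ↔ IsLCSQA Φ.star :=
  ⟨IsStable.isLCSQA hΦ, isStable_of_isLCSQA hΦ⟩

end PseudogroupAction

theorem theorem1p5 :
    -- equicontinuous pseudogroup actions on Cantor spaces
    (∀ (X : Type u) [MetricSpace X] [CompactSpace X] [TotallyDisconnectedSpace X] [PerfectSpace X]
        [Nonempty X] (Φ : PseudogroupAction X), Φ.IsEquicontinuous →
      (Φ.IsStable ↔ IsLCSQA Φ.star)) ∧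
    -- equicontinuous matchbox manifolds
    (∀ (n : ℕ) (M : Type v) [TopologicalSpace M], IsMatchboxManifold n M →
      ∀ (𝔛 : Type u) [MetricSpace 𝔛] [CompactSpace 𝔛] [TotallyDisconnectedSpace 𝔛]
        (𝒰 : RegularFoliatedCovering n M 𝔛), 𝒰.holonomy.IsEquicontinuous →
      (𝒰.holonomy.IsStable ↔ IsLCSQA 𝒰.holonomy.star)) := by
  exact ⟨fun X _ _ _ _ _ Φ hΦ => PseudogroupAction.isStable_iff_isLCSQA hΦ,
    fun n M _ _ 𝔛 _ _ _ 𝒰 h𝒰 => PseudogroupAction.isStable_iff_isLCSQA h𝒰⟩
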